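/- Formulas are built from a countably infinite set of propositional variables with the connectives $\top,\bot$ (nullary) and $\land,\lor,\to,\mathbin{-\!\!<}$ (binary; the last is exclusion). Put $\neg\varphi:=\varphi\to\bot$ and ${\sim}\varphi:=\top \mathbin{-\!\!<}\varphi$. *Weak bi-intuitionistic logic* $\mathrm{wBIL}$ is the consequence relation $\Gamma\vdash\varphi$ (with $\Gamma$ an arbitrary set of formulas) generated by the following rules: - $\Gamma\vdash\varphi$ whenever $\varphi$ is an instance of one of the axioms (A1) $\varphi\to(\psi\to\varphi)$; (A2) $(\varphi\to(\psi\to\chi))\to((\varphi\to\psi)\to(\varphi\to\chi))$; (A3) $\varphi\to(\varphi\lor\psi)$; (A4) $\psi\to(\varphi\lor\psi)$; (A5) $(\varphi\to\chi)\to((\psi\to\chi)\to((\varphi\lor\psi)\to\chi))$; (A6) $(\varphi\land\psi)\to\varphi$; (A7) $(\varphi\land\psi)\to\psi$; (A8) $(\chi\to\varphi)\to((\chi\to\psi)\to(\chi\to(\varphi\land\psi)))$; (A9) $\bot\to\varphi$; (A10) $\varphi\to\top$; (A11) $\varphi\to(\psi\lor(\varphi\mathbin{-\!\!<}\psi))$;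 (A12) $(\varphi\mathbin{-\!\!<}\psi)\to{\sim}(\varphi\to\psi)$; (A13) $((\varphi\mathbin{-\!\!<}\psi)\mathbin{-\!\!<}\chi)\to(\varphi\mathbin{-\!\!<}(\psi\lor\chi))$; (A14) $\neg(\varphi\mathbin{-\!\!<}\psi)\to(\varphi\to\psi)$; - $\Gamma\vdash\varphi$ whenever $\varphi\in\Gamma$; - if $\Gamma\vdash\varphi$ and $\Gamma\vdash\varphi\to\psi$, then $\Gamma\vdash\psi$; - if $\emptyset\vdash\varphi$, then $\Gamma\vdash\neg{\sim}\varphi$. For a class $K$ of algebras of this type, an equation (pair of formulas) $\epsilon=\delta$ and a set $\Theta$ of equations, write $\Theta\vDash_K\epsilon=\delta$ if every valuation in every algebra of $K$ that satisfies all equations of $\Theta$ satisfies $\epsilon=\delta$. A logic $\vdash$ is *algebraizable* if there are a class $K$ of algebras of its type, a (possibly infinite) set $\tau(x)$ of equations in one variable and a (possibly infinite) set $\Delta(x,y)$ of formulas in two variables such that for all sets $\Gamma\cup\{\varphi\}$ of formulas and all sets $\Theta\cup\{\epsilon=\delta\}$ of equations: 1. $\Gamma\vdash\varphi$ if and only if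 $\tau(\Gamma)\vDash_K\tau(\varphi)$; 2. $\Theta\vDash_K\epsilon=\delta$ if and only if $\Delta(\Theta)\vdash\Delta(\epsilon,\delta)$; 3. $\{\varphi\}\vdash\Delta(\tau(\varphi))$ and $\Delta(\tau(\varphi))\vdash\varphi$; 4. $\{\epsilon=\delta\}\vDash_K\tau(\Delta(\epsilon,\delta))$ and $\tau(\Delta(\epsilon,\delta))\vDash_K\epsilon=\delta$. Here $\tau(\varphi)$ and $\Delta(\epsilon,\delta)$ are obtained by substitution, $\tau(\Gamma)=\bigcup_{\gamma\in\Gamma}\tau(\gamma)$, $\Delta(\Theta)=\bigcup_{(\epsilon=\delta)\in\Theta}\Delta(\epsilon,\delta)$, and a set on the right of $\vdash$ or $\vDash_K$ means that each of its members follows. **Theorem.** $\mathrm{wBIL}$ is not algebraizable. -/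

import Mathlib

/-! # Abstract algebraic logic over an algebraic language

An algebraic language (operation symbols with arities) is a `FirstOrder.Language` without relation
symbols, an algebra of type `L` is an `L.Structure`, and the formulas over the countably infinite
set `ℕ` of propositional variables are the terms `L.Term ℕ`. A valuation `v : ℕ → A` extends to
formulas by `Term.realize v`, and a substitution `σ : ℕ → L.Term ℕ` acts on formulas by
`Term.subst`. -/

universe u v w

namespace AAL

/-- Formulas of an algebraic language. -/
abbrev Form (L : FirstOrder.Language.{u, v}) : Type u := L.Term ℕ

/-- An equation is a pair of formulas. -/
abbrev Equation (L : FirstOrder.Language.{u, v}) : Type u := Form L × Form L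

/-- A logic of type `L`: a structural consequence relation from sets of formulas to formulas. -/
structure Logic (L : FirstOrder.Language.{u, v}) [L.IsAlgebraic] where
  /-- `Entails Γ φ` is `Γ ⊢ φ`. -/
  Entails : Set (Form L) → Form L → Prop
  identity : ∀ (Γ : Set (Form L)) (φ : Form L), φ ∈ Γ → Entails Γ φ
  monotonicity : ∀ (Γ Δ : Set (Form L)) (φ : Form L), Entails Γ φ → Γ ⊆ Δ → Entails Δ φ
  cut : ∀ (Γ Δ : Set (Form L)) (φ : Form L),
    Entails Γ φ → (∀ ψ ∈ Γ, Entails Δ ψ) → Entails Δ φ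
  structurality : ∀ (Γ : Set (Form L)) (φ : Form L) (σ : ℕ → Form L),
    Entails Γ φ → Entails ((fun γ => γ.subst σ) '' Γ) (φ.subst σ)

/-- `Γ ⊢ Δ`: every formula of `Δ` follows from `Γ`. -/
def Logic.EntailsSet {L : FirstOrder.Language.{u, v}} [L.IsAlgebraic] (S : Logic L)
    (Γ Δ : Set (Form L)) : Prop :=
  ∀ δ ∈ Δ, S.Entails Γ δ

/-- Equational consequence `Θ ⊨_K e` on a class `K` of algebras. -/
def EqConseq {L : FirstOrder.Language.{u, v}} (K : Set (CategoryTheory.Bundled.{w} L.Structure))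
    (Θ : Set (Equation L)) (e : Equation L) : Prop :=
  ∀ A ∈ K, ∀ val : ℕ → A,
    (∀ t ∈ Θ, t.1.realize val = t.2.realize val) → e.1.realize val = e.2.realize val

/-- `Θ ⊨_K Ξ`: every equation of `Ξ` follows from `Θ` on `K`. -/
def EqConseqSet {L : FirstOrder.Language.{u, v}} (K : Set (CategoryTheory.Bundled.{w} L.Structure))
    (Θ Ξ : Set (Equation L)) : Prop :=
  ∀ e ∈ Ξ, EqConseq K Θ e

/-- `τ(φ)`, for a set `τ(x)` of equations in one variable. -/
def eqInst {L : FirstOrder.Language.{u, v}} (τ : Set (L.Term (Fin 1) × L.Term (Fin 1))) (φ : Form L) :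
    Set (Equation L) :=
  (fun e => (e.1.subst fun _ => φ, e.2.subst fun _ => φ)) '' τ

/-- `τ(Γ)`, the union of the `τ(γ)` for `γ ∈ Γ`. -/
def eqInstSet {L : FirstOrder.Language.{u, v}} (τ : Set (L.Term (Fin 1) × L.Term (Fin 1)))
    (Γ : Set (Form L)) : Set (Equation L) :=
  ⋃ γ ∈ Γ, eqInst τ γ

/-- `Δ(ε, δ)`, for a set `Δ(x, y)` of formulas in two variables and an equation `e = (ε, δ)`. -/
def formInst {L : FirstOrder.Language.{u, v}} (Δ : Set (L.Term (Fin 2))) (e : Equation L) : Set (Form L) :=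
  (fun t => t.subst ![e.1, e.2]) '' Δ

/-- `Δ(Θ)`, the union of the `Δ(ε, δ)` for `(ε, δ) ∈ Θ`. -/
def formInstSet {L : FirstOrder.Language.{u, v}} (Δ : Set (L.Term (Fin 2))) (Θ : Set (Equation L)) :
    Set (Form L) :=
  ⋃ e ∈ Θ, formInst Δ e

/-- `S` is algebraizable with respect to the class `K`, with defining equations `τ(x)` and
equivalence formulas `Δ(x, y)`; both sets may be infinite. -/
structure AlgebraizableVia {L : FirstOrder.Language.{u, v}} [L.IsAlgebraic] (S : Logic L)
    (K : Set (CategoryTheory.Bundled.{w} L.Structure))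
    (τ : Set (L.Term (Fin 1) × L.Term (Fin 1))) (Δ : Set (L.Term (Fin 2))) : Prop where
  alg1 : ∀ (Γ : Set (Form L)) (φ : Form L),
    S.Entails Γ φ ↔ EqConseqSet K (eqInstSet τ Γ) (eqInst τ φ)
  alg2 : ∀ (Θ : Set (Equation L)) (e : Equation L),
    EqConseq K Θ e ↔ S.EntailsSet (formInstSet Δ Θ) (formInst Δ e)
  alg3 : ∀ φ : Form L,
    S.EntailsSet {φ} (formInstSet Δ (eqInst τ φ)) ∧ S.Entails (formInstSet Δ (eqInst τ φ)) φ
  alg4 : ∀ e : Equation L,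
    EqConseqSet K {e} (eqInstSet τ (formInst Δ e)) ∧ EqConseq K (eqInstSet τ (formInst Δ e)) e

/-- `S` is algebraizable with respect to the class `K` of algebras. -/
def AlgebraizableWrt {L : FirstOrder.Language.{u, v}} [L.IsAlgebraic] (S : Logic L)
    (K : Set (CategoryTheory.Bundled.{w} L.Structure)) : Prop :=
  ∃ (τ : Set (L.Term (Fin 1) × L.Term (Fin 1))) (Δ : Set (L.Term (Fin 2))),
    AlgebraizableVia S K τ Δ

/-- `S` is algebraizable with respect to some class of algebras (with carriers in `Type w`). -/
def Algebraizable {L : FirstOrder.Language.{u, v}} [L.IsAlgebraic] (S : Logic L) : Prop :=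
  ∃ K : Set (CategoryTheory.Bundled.{w} L.Structure), AlgebraizableWrt S K

end AAL

/-! # Weak bi-intuitionistic logic -/

namespace BiInt

open AAL

/-- The operation symbols `⊤, ⊥, ∧, ∨, →` and exclusion, indexed by their arities. -/
inductive Op : ℕ → Type
  | top : Op 0
  | bot : Op 0
  | and : Op 2
  | or : Op 2
  | imp : Op 2
  | excl : Op 2

/-- The bi-intuitionistic propositional language. -/
def lang : FirstOrder.Language.{0, 0} := ⟨Op, fun _ => Empty⟩

instance : lang.IsAlgebraic := fun _ => inferInstanceAs (IsEmpty Empty)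

/-- Bi-intuitionistic formulas. -/
abbrev BForm : Type := Form lang

/-- The formula `⊤`. -/
def top : BForm := FirstOrder.Language.Term.func (L := lang) Op.top ![]
/-- The formula `⊥`. -/
def bot : BForm := FirstOrder.Language.Term.func (L := lang) Op.bot ![]
/-- Conjunction. -/
def and (φ ψ : BForm) : BForm := FirstOrder.Language.Term.func (L := lang) Op.and ![φ, ψ]
/-- Disjunction. -/
def or (φ ψ : BForm) : BForm := FirstOrder.Language.Term.func (L := lang) Op.or ![φ, ψ]
/-- Implication. -/
def imp (φ ψ : BForm) : BForm := FirstOrder.Language.Term.func (L := lang) Op.imp ![φ, ψ]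
/-- Exclusion, the dual of implication (`φ` excludes `ψ`). -/
def excl (φ ψ : BForm) : BForm := FirstOrder.Language.Term.func (L := lang) Op.excl ![φ, ψ]
/-- Negation `φ → ⊥`. -/
def neg (φ : BForm) : BForm := imp φ bot
/-- Co-negation: `⊤` excludes `φ`. -/
def coneg (φ : BForm) : BForm := excl top φ

/-- The axiom instances of the generalised Hilbert calculus. -/
inductive IsAxiom : BForm → Prop
  | a1 (φ ψ : BForm) : IsAxiom (imp φ (imp ψ φ))
  | a2 (φ ψ χ : BForm) : IsAxiom (imp (imp φ (imp ψ χ)) (imp (imp φ ψ) (imp φ χ)))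
  | a3 (φ ψ : BForm) : IsAxiom (imp φ (or φ ψ))
  | a4 (φ ψ : BForm) : IsAxiom (imp ψ (or φ ψ))
  | a5 (φ ψ χ : BForm) : IsAxiom (imp (imp φ χ) (imp (imp ψ χ) (imp (or φ ψ) χ)))
  | a6 (φ ψ : BForm) : IsAxiom (imp (and φ ψ) φ)
  | a7 (φ ψ : BForm) : IsAxiom (imp (and φ ψ) ψ)
  | a8 (φ ψ χ : BForm) : IsAxiom (imp (imp χ φ) (imp (imp χ ψ) (imp χ (and φ ψ))))
  | a9 (φ : BForm) : IsAxiom (imp bot φ)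
  | a10 (φ : BForm) : IsAxiom (imp φ top)
  | a11 (φ ψ : BForm) : IsAxiom (imp φ (or ψ (excl φ ψ)))
  | a12 (φ ψ : BForm) : IsAxiom (imp (excl φ ψ) (coneg (imp φ ψ)))
  | a13 (φ ψ χ : BForm) : IsAxiom (imp (excl (excl φ ψ) χ) (excl φ (or ψ χ)))
  | a14 (φ ψ : BForm) : IsAxiom (imp (neg (excl φ ψ)) (imp φ ψ))

/-- Derivability `Γ ⊢ φ` in the generalised Hilbert calculus for weak bi-intuitionistic logic. The
rule `wDN` only applies to formulas derived from no assumptions. -/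
inductive WDeriv : Set BForm → BForm → Prop
  | ax {Γ : Set BForm} {φ : BForm} (h : IsAxiom φ) : WDeriv Γ φ
  | el {Γ : Set BForm} {φ : BForm} (h : φ ∈ Γ) : WDeriv Γ φ
  | mp {Γ : Set BForm} {φ ψ : BForm} (h₁ : WDeriv Γ φ) (h₂ : WDeriv Γ (imp φ ψ)) : WDeriv Γ ψ
  | wdn {Γ : Set BForm} {φ : BForm} (h : WDeriv ∅ φ) : WDeriv Γ (neg (coneg φ))

theorem WDeriv.cut {Γ Δ : Set BForm} {φ : BForm} (h : WDeriv Γ φ)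
    (hΓ : ∀ ψ ∈ Γ, WDeriv Δ ψ) : WDeriv Δ φ := by
  induction h with
  | ax h => exact .ax h
  | el h => exact hΓ _ h
  | mp _ _ ih₁ ih₂ => exact .mp (ih₁ hΓ) (ih₂ hΓ)
  | wdn h _ => exact .wdn h

section Subst

variable (σ : ℕ → BForm) (φ ψ : BForm)

theorem subst_top : FirstOrder.Language.Term.subst top σ = top := by
  simp only [top, FirstOrder.Language.Term.subst]; congr 1; ext i; exact i.elim0

theorem subst_bot : FirstOrder.Language.Term.subst bot σ = bot := by
  simp only [bot, FirstOrder.Language.Term.subst]; congr 1; ext i; exact i.elim0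

theorem subst_and : (and φ ψ).subst σ = and (φ.subst σ) (ψ.subst σ) := by
  simp only [and, FirstOrder.Language.Term.subst]; congr 1; ext i; fin_cases i <;> rfl

theorem subst_or : (or φ ψ).subst σ = or (φ.subst σ) (ψ.subst σ) := by
  simp only [or, FirstOrder.Language.Term.subst]; congr 1; ext i; fin_cases i <;> rfl

theorem subst_imp : (imp φ ψ).subst σ = imp (φ.subst σ) (ψ.subst σ) := by
  simp only [imp, FirstOrder.Language.Term.subst]; congr 1; ext i; fin_cases i <;> rfl

theorem subst_excl : (excl φ ψ).subst σ = excl (φ.subst σ) (ψ.subst σ) := by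
  simp only [excl, FirstOrder.Language.Term.subst]; congr 1; ext i; fin_cases i <;> rfl

theorem subst_neg : (neg φ).subst σ = neg (φ.subst σ) := by
  rw [neg, subst_imp, subst_bot, neg]

theorem subst_coneg : (coneg φ).subst σ = coneg (φ.subst σ) := by
  rw [coneg, subst_excl, subst_top, coneg]

end Subst

theorem IsAxiom.subst {φ : BForm} (h : IsAxiom φ) (σ : ℕ → BForm) : IsAxiom (φ.subst σ) := by
  cases h <;>
    simp only [subst_top, subst_bot, subst_and, subst_or, subst_imp, subst_excl, subst_neg,
      subst_coneg] <;>
    constructor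

theorem WDeriv.subst {Γ : Set BForm} {φ : BForm} (h : WDeriv Γ φ) (σ : ℕ → BForm) :
    WDeriv ((fun γ => γ.subst σ) '' Γ) (φ.subst σ) := by
  induction h with
  | ax h => exact .ax (h.subst σ)
  | el h => exact .el ⟨_, h, rfl⟩
  | mp _ _ ih₁ ih₂ => exact .mp ih₁ (by rwa [subst_imp] at ih₂)
  | wdn _ ih =>
    rw [subst_neg, subst_coneg]
    exact .wdn (by rwa [Set.image_empty] at ih)

/-- Weak bi-intuitionistic logic. -/
def wBIL : Logic lang where
  Entails := WDeriv
  identity _ _ h := .el h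
  monotonicity _ _ _ h hs := h.cut fun _ hψ => .el (hs hψ)
  cut _ _ _ h hs := h.cut hs
  structurality _ _ σ h := h.subst σ

end BiInt

/-! # Protoalgebraic consequences of algebraizability -/

namespace AAL

variable {L : FirstOrder.Language.{u, v}} [L.IsAlgebraic] {S : Logic L}
  {K : Set (CategoryTheory.Bundled.{w} L.Structure)}
  {τ : Set (L.Term (Fin 1) × L.Term (Fin 1))} {Δ : Set (L.Term (Fin 2))}

/-! Algebraizability makes a filter recoverable from its Leibniz congruence, since `φ` is
interderivable with `Δ(τ(φ))`. On the chain `0 < 1 < 2`, both `{2}` and `{1, 2}` are closed under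
derivation (`WDeriv.le_realize`). The operation `¬∼` fixes `2` and sends `0` and `1` to `0`, so a
congruence compatible with `{1, 2}` is the identity (`realize_eq_of_formInst`). Evaluate a variable
`x` at `1`: `Δ(τ(x))` lies in `{1, 2}`, so the equations `τ(x)` hold at `1`. By reflexivity
`Δ(τ(x))` then has value `2`, which forces `x` into `{2}`. The chain need not belong to `K`: only
derivability is transported to it. -/

/-- The equivalence formulas of an algebraizable logic are reflexive. -/
theorem AlgebraizableVia.entailsSet_formInst_self (h : AlgebraizableVia S K τ Δ) (φ : Form L) :
    S.EntailsSet ∅ (formInst Δ (φ, φ)) := by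
  have := (h.alg2 ∅ (φ, φ)).1 fun _ _ _ _ => rfl
  simpa [formInstSet] using this

/-- Modus ponens for the equivalence formulas: if the equation `χ = χ'` follows from `e` in every
algebra, then `Δ(e), χ ⊢ χ'`. -/
theorem AlgebraizableVia.entails_of_formInst (h : AlgebraizableVia S K τ Δ) {e : Equation L}
    {χ χ' : Form L}
    (hχ : ∀ (A : Type w) [L.Structure A] (val : ℕ → A),
      e.1.realize val = e.2.realize val → χ.realize val = χ'.realize val) :
    S.Entails (insert χ (formInst Δ e)) χ' := by
  rw [h.alg1]
  rintro _ ⟨t, ht, rfl⟩ A hA val hval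
  -- `τ(Δ(e))` is among the premises and gives back `e`; hence `χ` and `χ'` have the same value and
  -- satisfy the same equations of `τ`.
  have he : e.1.realize val = e.2.realize val := by
    refine (h.alg4 e).2 A hA val fun s hs => hval s ?_
    rw [eqInstSet, Set.mem_iUnion₂] at hs ⊢
    obtain ⟨γ, hγ, hs⟩ := hs
    exact ⟨γ, Set.mem_insert_of_mem _ hγ, hs⟩
  have hτ := hval (t.1.subst fun _ => χ, t.2.subst fun _ => χ)
    (Set.mem_iUnion₂.2 ⟨χ, Set.mem_insert _ _, t, ht, rfl⟩)
  simpa only [FirstOrder.Language.Term.realize_subst, hχ A val he] using hτ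

end AAL

/-! # The three-element bi-Heyting chain -/

namespace BiInt

open AAL

/-- Implication of the three-element chain. -/
def chainImp (a b : Fin 3) : Fin 3 := if a ≤ b then 2 else b

/-- Exclusion of the three-element chain. -/
def chainExcl (a b : Fin 3) : Fin 3 := if a ≤ b then 0 else a

/-- The three-element chain `0 < 1 < 2` as a bi-Heyting algebra. -/
instance chainStructure : lang.Structure (Fin 3) where
  funMap {_} f :=
    match f with
    | Op.top => fun _ => 2
    | Op.bot => fun _ => 0
    | Op.and => fun x => min (x 0) (x 1)
    | Op.or => fun x => max (x 0) (x 1)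
    | Op.imp => fun x => chainImp (x 0) (x 1)
    | Op.excl => fun x => chainExcl (x 0) (x 1)
  RelMap r _ := r.elim

section Realize

variable (val : ℕ → Fin 3) (φ ψ : BForm)

theorem realize_top : top.realize val = (2 : Fin 3) := rfl

theorem realize_bot : bot.realize val = (0 : Fin 3) := rfl

theorem realize_and : (and φ ψ).realize val = min (φ.realize val) (ψ.realize val) := rfl

theorem realize_or : (or φ ψ).realize val = max (φ.realize val) (ψ.realize val) := rfl

theorem realize_imp : (imp φ ψ).realize val =
    chainImp (φ.realize val) (ψ.realize val) := rfl

theorem realize_excl : (excl φ ψ).realize val =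
    chainExcl (φ.realize val) (ψ.realize val) := rfl

/-- Lets the filter `{1, 2}` detect the value `2`, although it contains `1` as well. -/
theorem one_le_realize_neg_coneg :
    (1 : Fin 3) ≤ (neg (coneg φ)).realize val ↔ φ.realize val = 2 := by
  simp only [neg, coneg, realize_imp, realize_excl, realize_top, realize_bot]
  generalize φ.realize val = a
  revert a
  decide

end Realize

theorem IsAxiom.realize_eq_two {φ : BForm} (h : IsAxiom φ) (val : ℕ → Fin 3) :
    φ.realize val = (2 : Fin 3) := by
  cases h <;>
    simp only [neg, coneg, realize_imp, realize_excl, realize_top, realize_bot, realize_and,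
      realize_or]
  case a1 φ ψ | a3 φ ψ | a4 φ ψ | a6 φ ψ | a7 φ ψ | a11 φ ψ | a12 φ ψ | a14 φ ψ =>
    generalize φ.realize val = a
    generalize ψ.realize val = b
    revert a b
    decide
  case a2 φ ψ χ | a5 φ ψ χ | a8 φ ψ χ | a13 φ ψ χ =>
    generalize φ.realize val = a
    generalize ψ.realize val = b
    generalize χ.realize val = c
    revert a b c
    decide
  case a9 φ | a10 φ =>
    generalize φ.realize val = a
    revert a
    decide

/-- Every principal filter of the three-element chain is a deductive filter of `wBIL`. -/
theorem WDeriv.le_realize {Γ : Set BForm} {φ : BForm} (h : WDeriv Γ φ) (val : ℕ → Fin 3)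
    (k : Fin 3) (hΓ : ∀ γ ∈ Γ, k ≤ γ.realize val) : k ≤ φ.realize val := by
  induction h generalizing k with
  | ax h => rw [h.realize_eq_two]; exact Fin.le_last k
  | el h => exact hΓ _ h
  | mp _ _ ih₁ ih₂ =>
    have h₁ := ih₁ k hΓ
    have h₂ := ih₂ k hΓ
    rw [realize_imp, chainImp] at h₂
    split_ifs at h₂ with hle
    · exact h₁.trans hle
    · exact h₂
  | wdn _ ih =>
    -- The premise has no assumptions, so its threshold can be raised from `k` to `2`; this is where
    -- the restriction of the rule to theorems matters.
    have h₂ := le_antisymm (Fin.le_last _) (ih 2 fun _ h => h.elim)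
    simp only [neg, coneg, realize_imp, realize_excl, realize_top, realize_bot]
    exact h₂ ▸ Fin.le_last k

/-- On the three-element chain, `{0}`, `{1}` and `{2}` are separated by the filter `{1, 2}` and the
operation `¬∼`. -/
theorem eq_of_filter_iff {a b : Fin 3} (h₁ : 1 ≤ a ↔ 1 ≤ b) (h₂ : a = 2 ↔ b = 2) : a = b := by
  revert a b
  decide

/-- The filter `{1, 2}` of the three-element chain has trivial Leibniz congruence. -/
theorem realize_eq_of_formInst {K : Set (CategoryTheory.Bundled.{w} lang.Structure)}
    {τ : Set (lang.Term (Fin 1) × lang.Term (Fin 1))} {Δ : Set (lang.Term (Fin 2))}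
    (h : AlgebraizableVia wBIL K τ Δ) (e : Equation lang) (val : ℕ → Fin 3)
    (he : ∀ t ∈ formInst Δ e, (1 : Fin 3) ≤ t.realize val) :
    e.1.realize val = e.2.realize val := by
  have key {χ χ' : BForm}
      (hχ : ∀ (A : Type w) [lang.Structure A] (val : ℕ → A),
        e.1.realize val = e.2.realize val → χ.realize val = χ'.realize val)
      (h₁ : (1 : Fin 3) ≤ χ.realize val) : (1 : Fin 3) ≤ χ'.realize val :=
    WDeriv.le_realize (h.entails_of_formInst hχ) val 1 (Set.forall_mem_insert.2 ⟨h₁, he⟩)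
  have congr_neg_coneg (A : Type w) [lang.Structure A] (val : ℕ → A) {φ ψ : BForm}
      (hφ : φ.realize val = ψ.realize val) :
      (neg (coneg φ)).realize val = (neg (coneg ψ)).realize val := by
    -- As a substitution instance of a one-variable formula, `¬∼χ` depends only on the value of `χ`,
    -- in any algebra.
    have hsub (χ : BForm) : neg (coneg χ) = (neg (coneg (.var 0))).subst fun _ => χ := by
      rw [subst_neg, subst_coneg]; rfl
    rw [hsub φ, hsub ψ]
    simp only [FirstOrder.Language.Term.realize_subst, hφ]
  refine eq_of_filter_iff ⟨key fun _ _ _ h => h, key fun _ _ _ h => h.symm⟩ ?_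
  rw [← one_le_realize_neg_coneg, ← one_le_realize_neg_coneg]
  exact ⟨key fun A _ val h => congr_neg_coneg A val h,
    key fun A _ val h => congr_neg_coneg A val h.symm⟩

end BiInt

open AAL BiInt in
/-- An algebraizable logic cannot have two deductive filters with the same Leibniz congruence, but
on the three-element chain both `{2}` and `{1, 2}` have the trivial one. -/
theorem algebraizableVia_wBIL_false {K : Set (CategoryTheory.Bundled.{w} lang.Structure)}
    {τ : Set (lang.Term (Fin 1) × lang.Term (Fin 1))} {Δ : Set (lang.Term (Fin 2))}
    (h : AlgebraizableVia wBIL K τ Δ) : False := by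
  let φ : BForm := .var 0
  -- The value `1` lies in `{1, 2}` but not in `{2}`.
  let val : ℕ → Fin 3 := fun _ => 1
  have hφ : (2 : Fin 3) ≤ φ.realize val := by
    refine WDeriv.le_realize (h.alg3 φ).2 val 2 fun t ht => ?_
    rw [formInstSet, Set.mem_iUnion₂] at ht
    obtain ⟨e, he, s, hs, rfl⟩ := ht
    have heq : e.1.realize val = e.2.realize val :=
      realize_eq_of_formInst h e val fun t ht =>
        WDeriv.le_realize ((h.alg3 φ).1 t (Set.mem_iUnion₂.2 ⟨e, he, ht⟩)) val 1
          fun γ hγ => by rw [Set.mem_singleton_iff.1 hγ]; exact le_rfl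
    -- `Δ(ε, ε)` is a set of theorems, so it has value `2`; as both sides of `e` have equal values,
    -- so does `Δ(e)`.
    have hrefl : (2 : Fin 3) ≤ (s.subst ![e.1, e.1]).realize val :=
      WDeriv.le_realize (h.entailsSet_formInst_self e.1 _ ⟨s, hs, rfl⟩) val 2
        fun _ h => h.elim
    have hfun : (fun i => ((![e.1, e.2] : Fin 2 → BForm) i).realize val) =
        fun i => ((![e.1, e.1] : Fin 2 → BForm) i).realize val := by
      funext i
      fin_cases i
      exacts [rfl, heq.symm]
    rw [FirstOrder.Language.Term.realize_subst] at hrefl ⊢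
    rwa [hfun]
  exact absurd hφ (by decide : ¬ (2 : Fin 3) ≤ 1)

/-- Weak bi-intuitionistic logic is not algebraizable. -/
theorem mainTheorem3 : ¬ AAL.Algebraizable.{0, 0, w} BiInt.wBIL := by
  rintro ⟨K, τ, Δ, h⟩
  exact algebraizableVia_wBIL_false h
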